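/- Let $\mathbb D$ be the open unit disc, let $L^2_a$ be the Bergman space of holomorphic functions on $\mathbb D$ that are square integrable with respect to area measure, and let $P:L^2(\mathbb D)\to L^2_a$ be the orthogonal projection. For a bounded operator $A$ on $L^2_a$, let $\mathrm{Ext}(A)$ be the set of all $\lambda\in\mathbb C$ for which there is a bounded operator $X\ne 0$ on $L^2_a$ with $AX=\lambda XA$; such an $X$ is called an extended eigenoperator of $A$ for $\lambda$. Let $a\in\mathbb C$, $c\in\mathbb D$ and $\varphi(z)=a(z-c)+c$, where either $c\neq 0$ and $|a|+|1-a||c|\le 1$, or $c=0$ and $|a|<1$. Suppose that $\varphi$ is loxodromic ($a\neq 0$, $|a|\ne 1$, and $a$ is not a positive real number) or a hyperbolic non-automorphism of the third kind of $\mathbb D$ ($a$ is a positive real number, $a\neq 1$, $\varphi(\mathbb D)\ne\mathbb D$, and of the fixed points $c,\infty$ the first lies in $\mathbb D$ and the second outside $\overline{\mathbb D}$). Then $C_\varphi f=f\circ\varphi$ defines a bounded operator on $L^2_a$, and $$\mathrm{Ext}(C_\varphi)=\{\varphi'(c)^n:\ n\in\mathbb Z\}.$$ Moreover: (i) for every integer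 $n\ge 0$, multiplication by $(z-c)^n$ is a bounded operator on $L^2_a$ and is an extended eigenoperator of $C_\varphi$ for $\varphi'(c)^n$; (ii) for every integer $k\ge 0$ there is a bounded operator $X_k$ on $L^2_a$ that agrees with the Toeplitz operator $T_{(z-c)^{-k}}f=P\big((z-c)^{-k}f\big)$ at every $f\in L^2_a$ with $(z-c)^{-k}f\in L^2(\mathbb D)$, that maps $(z-c)^j$ to $0$ for $0\le j<k$, and that is an extended eigenoperator of $C_\varphi$ for $\varphi'(c)^{-k}$. -/

import Mathlib

open MeasureTheory Metric

/-! ### Extended eigenvalues of bounded operators -/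

section Extended

variable {H : Type*} [NormedAddCommGroup H] [NormedSpace ℂ H]

/-- `X` is an extended eigenoperator of `A` for the scalar `lam`:
a nonzero bounded operator with `A X = lam X A`. -/
def IsExtendedEigenoperator (A : H →L[ℂ] H) (lam : ℂ) (X : H →L[ℂ] H) : Prop :=
  X ≠ 0 ∧ A ∘L X = lam • (X ∘L A)

/-- The extended spectrum `Ext(A)`: the set of all extended eigenvalues of `A`. -/
def extendedSpectrum (A : H →L[ℂ] H) : Set ℂ :=
  {lam | ∃ X : H →L[ℂ] H, IsExtendedEigenoperator A lam X}

end Extended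

/-! ### The Bergman space of the unit disc -/

/-- Area measure on the open unit disc. (Dividing it by `π` would multiply the norm of the Bergman
space by a constant and change none of the operators below.) -/
noncomputable abbrev discArea : Measure ℂ := volume.restrict (ball (0 : ℂ) 1)

/-- The Bergman space `L²_a`: the elements of `L²` of the unit disc that have a representative
which is holomorphic on the disc, with the norm and inner product of `L²`. -/
noncomputable def bergmanSpace : Submodule ℂ (Lp ℂ 2 discArea) where
  carrier := {f | ∃ g : ℂ → ℂ, DifferentiableOn ℂ g (ball 0 1) ∧ f =ᵐ[discArea] g}
  zero_mem' := ⟨fun _ => 0, differentiableOn_const _, Lp.coeFn_zero ℂ 2 discArea⟩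
  add_mem' := by
    rintro f₁ f₂ ⟨g₁, hg₁, h₁⟩ ⟨g₂, hg₂, h₂⟩
    exact ⟨g₁ + g₂, hg₁.add hg₂, (Lp.coeFn_add f₁ f₂).trans (h₁.add h₂)⟩
  smul_mem' := by
    rintro s f ⟨g, hg, h⟩
    exact ⟨s • g, hg.const_smul s, (Lp.coeFn_smul s f).trans (h.const_smul s)⟩

/-- The element `f` of the Bergman space is (the class of) the function `g`, holomorphic on the
unit disc. The values of `g` on the disc are determined by `f`. -/
def IsHolomorphicRep (f : bergmanSpace) (g : ℂ → ℂ) : Prop :=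
  DifferentiableOn ℂ g (ball 0 1) ∧ (f : Lp ℂ 2 discArea) =ᵐ[discArea] g

/-- `C` is the composition operator `C_φ f = f ∘ φ` on the Bergman space. -/
def IsCompositionOperator (φ : ℂ → ℂ) (C : bergmanSpace →L[ℂ] bergmanSpace) : Prop :=
  ∀ (f : bergmanSpace) (g : ℂ → ℂ), IsHolomorphicRep f g → IsHolomorphicRep (C f) (g ∘ φ)

/-- `M` is the multiplication operator `M_b f = b f` on the Bergman space. -/
def IsMultiplicationOperator (b : ℂ → ℂ) (M : bergmanSpace →L[ℂ] bergmanSpace) : Prop :=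
  ∀ (f : bergmanSpace) (g : ℂ → ℂ), IsHolomorphicRep f g →
    IsHolomorphicRep (M f) (fun z => b z * g z)

/-- `X` agrees with the Toeplitz operator `T_s f = P (s f)` wherever the latter is defined, that is
at every `f` in the Bergman space with `s f` in `L²` of the disc. Here `P` is the orthogonal
projection of `L²` onto the Bergman space, so `X f = P u` means that `u - X f` is orthogonal to the
Bergman space. -/
def ExtendsToeplitzOperator (s : ℂ → ℂ) (X : bergmanSpace →L[ℂ] bergmanSpace) : Prop :=
  ∀ (f : bergmanSpace) (hs : MemLp (fun z => s z * (f : Lp ℂ 2 discArea) z) 2 discArea),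
    hs.toLp (fun z => s z * (f : Lp ℂ 2 discArea) z) - (X f : Lp ℂ 2 discArea) ∈ bergmanSpaceᗮ

/-! ### The linear fractional maps with fixed points `c` and `∞` -/

/-- `φ(z) = a (z - c) + c`. -/
def affineSelfMap (a c : ℂ) (z : ℂ) : ℂ := a * (z - c) + c

/-- The map `z ↦ a (z - c) + c`, whose multiplier is `a`, is loxodromic: `a` is neither `0`,
nor of modulus one, nor a positive real number. -/
def IsLoxodromic (a : ℂ) : Prop := a ≠ 0 ∧ ‖a‖ ≠ 1 ∧ ∀ r : ℝ, 0 < r → a ≠ r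

/-- The map `z ↦ a (z - c) + c` is hyperbolic: its multiplier is a positive real number
other than one. -/
def IsHyperbolic (a : ℂ) : Prop := ∃ r : ℝ, 0 < r ∧ r ≠ 1 ∧ a = r

/-- The map `z ↦ a (z - c) + c` is a hyperbolic non-automorphism of the third kind of the unit disc:
it is hyperbolic, is not an automorphism of the disc, and its fixed point `c` lies in the open disc
(its other fixed point `∞` lies outside the closed disc). -/
def IsHyperbolicNonautIII (a c : ℂ) : Prop :=
  IsHyperbolic a ∧ ‖c‖ < 1 ∧ affineSelfMap a c '' ball 0 1 ≠ ball 0 1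

/-! Let `C` be the composition operator, `M` multiplication by `z - c`, `B f = (f - f(c)) / (z - c)`
and `e = 1`. Since `φ(z) - c = a (z - c)`, one has `C M = a M C`, `C B = a⁻¹ B C`, `C e = e`, `f =
f(c) e + M B f` and `B M = 1`. So `M ^ n` and `B ^ n` are extended eigenoperators for `a ^ n` and `a
^ (-n)`; they are nonzero because `B ^ n M ^ n e = e`.

Conversely, if `C X = lam X C`, each `X (M ^ n e)` satisfies the eigenvector equation of `C` for
`lam * a ^ n`. Some of these vectors is nonzero (`eq_zero_of_forall_eq_zero`), and eigenvalues of
`C` are powers of `a` (`eigenvalue_eq_pow`), so `lam` is an integer power of `a`. Both lemmas rest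
on `exists_norm_le`: for a suitable `N`, `C ^ N` sends the Taylor remainders `M ^ n B ^ n f` to `0`
as `n` grows, and `C ^ N` is injective.

On the Bergman space the analytic points are the boundedness of `B` and the fact that `1 / (z - c)`
is not square integrable, which makes `B ^ k` extend the Toeplitz operator. -/

open scoped ENNReal NNReal

/-! ### Extended eigenvalues for an abstract scaled shift -/

section Abstract

variable {H : Type*} [NormedAddCommGroup H] [NormedSpace ℂ H]

/-- `B` is a left inverse of `M` up to rank one, and `C` scales `M` and `B` by `a` and `a⁻¹`. -/
structure IsScaledShift (a : ℂ) (C M B : H →L[ℂ] H) (e : H) : Prop where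
  ne_zero : a ≠ 0
  norm_lt_one : ‖a‖ < 1
  comp_shift : ∀ f, C (M f) = a • M (C f)
  comp_backward : ∀ f, C (B f) = a⁻¹ • B (C f)
  map_vector : C e = e
  decomp : ∀ f, ∃ s : ℂ, f = s • e + M (B f)
  inj : ∀ f, C f = 0 → f = 0

namespace IsScaledShift

variable {a : ℂ} {C M B : H →L[ℂ] H} {e : H} (h : IsScaledShift a C M B e)
include h

lemma comp_shift_pow (n : ℕ) (f : H) : C ((M ^ n) f) = a ^ n • (M ^ n) (C f) := by
  induction n generalizing f with
  | zero => simp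
  | succ n ih =>
    rw [pow_succ, mul_apply_eq_comp, mul_apply_eq_comp, ih, h.comp_shift,
      map_smul, smul_smul, pow_succ]

lemma comp_backward_pow (n : ℕ) (f : H) : C ((B ^ n) f) = (a ^ n)⁻¹ • (B ^ n) (C f) := by
  induction n generalizing f with
  | zero => simp
  | succ n ih =>
    rw [pow_succ, mul_apply_eq_comp, mul_apply_eq_comp, ih,
      h.comp_backward, map_smul, smul_smul, pow_succ, mul_inv]

lemma pow_comp_shift_pow (N n : ℕ) (f : H) :
    (C ^ N) ((M ^ n) f) = (a ^ N) ^ n • (M ^ n) ((C ^ N) f) := by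
  induction N generalizing f with
  | zero => simp
  | succ N ih =>
    rw [pow_succ, mul_apply_eq_comp, mul_apply_eq_comp,
      h.comp_shift_pow, map_smul, ih, smul_smul]
    congr 1
    rw [← mul_pow, pow_succ']

lemma pow_inj (N : ℕ) (f : H) (hf : (C ^ N) f = 0) : f = 0 := by
  induction N with
  | zero => simpa using hf
  | succ N ih =>
    rw [pow_succ', mul_apply_eq_comp] at hf
    exact ih (h.inj _ hf)

/-- Moving `C ^ N` past `M ^ n` gains the factor `(a ^ N) ^ n`, which beats the growth `(‖M‖ ‖B‖) ^
n` once `‖a‖ ^ N ‖M‖ ‖B‖ < 1`. A power of `C` is needed because `‖a‖ ‖M‖ ‖B‖` itself may exceed one.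
-/
lemma exists_norm_le : ∃ (N : ℕ) (q : ℝ), 0 ≤ q ∧ q < 1 ∧ ∀ (n : ℕ) (f : H),
    ‖(C ^ N) ((M ^ n) ((B ^ n) f))‖ ≤ q ^ n * (‖C ^ N‖ * ‖f‖) := by
  have ht : Filter.Tendsto (fun N : ℕ => ‖a‖ ^ N * (‖M‖ * ‖B‖)) Filter.atTop (nhds 0) := by
    simpa using (tendsto_pow_atTop_nhds_zero_of_lt_one (norm_nonneg a) h.norm_lt_one).mul_const
      (‖M‖ * ‖B‖)
  obtain ⟨N, hN⟩ := (ht.eventually (gt_mem_nhds zero_lt_one)).exists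
  refine ⟨N, ‖a‖ ^ N * (‖M‖ * ‖B‖), by positivity, hN, fun n f => ?_⟩
  have hpow : ∀ (T : H →L[ℂ] H) (g : H), ‖(T ^ n) g‖ ≤ ‖T‖ ^ n * ‖g‖ := by
    intro T g
    induction n generalizing g with
    | zero => simp
    | succ n ih =>
      rw [pow_succ, mul_apply_eq_comp, pow_succ, mul_assoc]
      exact (ih _).trans (by gcongr; exact T.le_opNorm g)
  rw [h.pow_comp_shift_pow, norm_smul, norm_pow, norm_pow]
  calc (‖a‖ ^ N) ^ n * ‖(M ^ n) ((C ^ N) ((B ^ n) f))‖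
      ≤ (‖a‖ ^ N) ^ n * (‖M‖ ^ n * (‖C ^ N‖ * (‖B‖ ^ n * ‖f‖))) := by
        gcongr
        refine (hpow M _).trans ?_
        gcongr
        refine ((C ^ N).le_opNorm _).trans ?_
        gcongr
        exact hpow B f
    _ = _ := by rw [mul_pow, mul_pow]; ring

/-- An operator killing all "monomials" `M ^ n e` sees only Taylor remainders, so `C ^ N X f = lam ^
N X (C ^ N M ^ n B ^ n f)` for every `n`. The right side tends to `0`. This replaces density of
polynomials. -/
lemma eq_zero_of_forall_eq_zero {lam : ℂ} {X : H →L[ℂ] H} (hX : ∀ f, C (X f) = lam • X (C f))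
    (hM : ∀ n : ℕ, X ((M ^ n) e) = 0) : X = 0 := by
  have key : ∀ (n : ℕ) (f : H), X f = X ((M ^ n) ((B ^ n) f)) := by
    intro n
    induction n with
    | zero => simp
    | succ n ih =>
      intro f
      obtain ⟨s, hs⟩ := h.decomp ((B ^ n) f)
      rw [ih f, hs, map_add, map_add, map_smul, map_smul, hM, smul_zero, zero_add, pow_succ M,
        pow_succ' B]
      rfl
  have hXN : ∀ (N : ℕ) (f : H), (C ^ N) (X f) = lam ^ N • X ((C ^ N) f) := by
    intro N
    induction N with
    | zero => simp
    | succ N ih =>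
      intro f
      rw [pow_succ, mul_apply_eq_comp, mul_apply_eq_comp, hX, map_smul,
        ih, smul_smul, pow_succ']
  obtain ⟨N, q, hq0, hq1, hq⟩ := h.exists_norm_le
  ext f
  refine h.pow_inj N _ (norm_le_zero_iff.1 ?_)
  have ht : Filter.Tendsto (fun n : ℕ => ‖lam ^ N‖ * (‖X‖ * (q ^ n * (‖C ^ N‖ * ‖f‖))))
      Filter.atTop (nhds 0) := by
    simpa using (((tendsto_pow_atTop_nhds_zero_of_lt_one hq0 hq1).mul_const
      (‖C ^ N‖ * ‖f‖)).const_mul ‖X‖).const_mul ‖lam ^ N‖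
  refine ge_of_tendsto' ht fun n => ?_
  rw [key n f, hXN, norm_smul]
  gcongr
  exact (X.le_opNorm _).trans (by gcongr; exact hq n f)

/-- If `μ` is no power of `a`, all Taylor coefficients of the eigenvector vanish, so it equals each
of its remainders and is killed by `C ^ N`. -/
lemma eigenvalue_eq_pow {μ : ℂ} {f : H} (hf : f ≠ 0) (hμ : C f = μ • f) :
    ∃ m : ℕ, μ = a ^ m := by
  by_contra! hcon
  have key : ∀ n : ℕ, f = (M ^ n) ((B ^ n) f) := by
    intro n
    induction n with
    | zero => simp
    | succ n ih =>
      obtain ⟨s, hs⟩ := h.decomp ((B ^ n) f)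
      have hB : C ((B ^ n) f) = ((a ^ n)⁻¹ * μ) • (B ^ n) f := by
        rw [h.comp_backward_pow, hμ, map_smul, smul_smul]
      -- The vector `s • e = (1 - M B) (B ^ n f)` is fixed by `C`. As `M B` commutes with `C`, it is
      -- also scaled by `(a ^ n)⁻¹ * μ`, which is not `1`.
      have hse : s • e = 0 := by
        have hQ : s • e = (B ^ n) f - M (B ((B ^ n) f)) := eq_sub_of_add_eq hs.symm
        have hC : s • e = ((a ^ n)⁻¹ * μ) • (s • e) := by
          conv_lhs => rw [← h.map_vector, ← map_smul, hQ, map_sub, h.comp_shift, h.comp_backward,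
            map_smul, smul_smul, mul_inv_cancel₀ h.ne_zero, one_smul, hB, map_smul, map_smul]
          rw [hQ, smul_sub]
        by_contra hne
        apply hcon n
        have h1 : (1 - (a ^ n)⁻¹ * μ) • (s • e) = 0 := by
          rw [sub_smul, one_smul, ← hC, sub_self]
        have h2 := (smul_eq_zero.1 h1).resolve_right hne
        have han := pow_ne_zero n h.ne_zero
        field_simp at h2
        exact (sub_eq_zero.1 (h2.trans (mul_zero _))).symm
      rw [hse, zero_add] at hs
      conv_lhs => rw [ih, hs]
      rw [pow_succ M, pow_succ' B]
      rfl
  obtain ⟨N, q, hq0, hq1, hq⟩ := h.exists_norm_le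
  refine hf (h.pow_inj N _ (norm_le_zero_iff.1 ?_))
  have ht : Filter.Tendsto (fun n : ℕ => q ^ n * (‖C ^ N‖ * ‖f‖)) Filter.atTop (nhds 0) := by
    simpa using (tendsto_pow_atTop_nhds_zero_of_lt_one hq0 hq1).mul_const (‖C ^ N‖ * ‖f‖)
  refine ge_of_tendsto' ht fun n => ?_
  conv_lhs => rw [key n]
  exact hq n f

lemma exists_zpow_of_mem_extendedSpectrum {lam : ℂ} (hl : lam ∈ extendedSpectrum C) :
    ∃ n : ℤ, lam = a ^ n := by
  obtain ⟨X, hX0, hX⟩ := hl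
  have hX' : ∀ f, C (X f) = lam • X (C f) := fun f => by simpa using DFunLike.congr_fun hX f
  obtain ⟨n, hn⟩ : ∃ n : ℕ, X ((M ^ n) e) ≠ 0 := by
    by_contra! hcon
    exact hX0 (h.eq_zero_of_forall_eq_zero hX' hcon)
  obtain ⟨m, hm⟩ := h.eigenvalue_eq_pow (μ := lam * a ^ n) hn (by
    rw [hX', h.comp_shift_pow, h.map_vector, map_smul, smul_smul])
  refine ⟨m - n, ?_⟩
  rw [zpow_sub₀ h.ne_zero, zpow_natCast, zpow_natCast, ← hm,
    mul_div_cancel_right₀ _ (pow_ne_zero n h.ne_zero)]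

end IsScaledShift

end Abstract

/-! ### Point evaluations and boundedness of the difference quotient -/

section Analysis

/-- Area mean value inequality for holomorphic functions. -/
lemma mul_enorm_le_lintegral_ball {g : ℂ → ℂ} {w : ℂ} {ρ : ℝ} (hρ : 0 < ρ)
    (hg : DifferentiableOn ℂ g (ball w ρ)) :
    ENNReal.ofReal (Real.pi * ρ ^ 2) * ‖g w‖ₑ ≤ ∫⁻ z in ball w ρ, ‖g z‖ₑ := by
  set G : ℂ → ℂ := (ball w ρ).indicator g with hG
  have hGm : Measurable G := by
    classical
    have := ContinuousOn.measurable_piecewise (s := ball w ρ) (f := g) (g := fun _ => (0 : ℂ))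
      hg.continuousOn continuousOn_const measurableSet_ball
    rwa [show (ball w ρ).piecewise g (fun _ => 0) = G from Set.piecewise_eq_indicator] at this
  have h1 : ∫⁻ z in ball w ρ, ‖g z‖ₑ = ∫⁻ z, ‖G (w + z)‖ₑ := by
    rw [lintegral_add_left_eq_self (fun z => ‖G z‖ₑ) w, ← lintegral_indicator measurableSet_ball]
    refine lintegral_congr fun z => ?_
    by_cases hz : z ∈ ball w ρ <;> simp [hG, hz]
  have hmeas : Measurable fun p : ℝ × ℝ =>
      ENNReal.ofReal p.1 • ‖G (w + Complex.polarCoord.symm p)‖ₑ := by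
    have : Measurable fun p : ℝ × ℝ => w + Complex.polarCoord.symm p := by
      simp only [Complex.polarCoord_symm_apply]
      fun_prop
    exact (ENNReal.measurable_ofReal.comp measurable_fst).smul (hGm.comp this).enorm
  have htar : polarCoord.target = Set.Ioi (0 : ℝ) ×ˢ Set.Ioo (-Real.pi) Real.pi := rfl
  rw [h1, ← Complex.lintegral_comp_polarCoord_symm, htar, Measure.volume_eq_prod,
    ← Measure.prod_restrict, lintegral_prod _ hmeas.aemeasurable]
  have hcirc : ∀ r ∈ Set.Ioo 0 ρ, ENNReal.ofReal (2 * Real.pi) * ‖g w‖ₑ ≤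
      ∫⁻ θ in Set.Ioo (-Real.pi) Real.pi, ‖G (w + Complex.polarCoord.symm (r, θ))‖ₑ := by
    intro r hr
    have hsub : closedBall w r ⊆ ball w ρ := closedBall_subset_ball hr.2
    have hmv : Real.circleAverage g w r = g w := by
      refine DiffContOnCl.circleAverage ?_
      rw [abs_of_pos hr.1]
      exact (hg.mono hsub).diffContOnCl_ball subset_rfl
    -- The average is shifted to start at `-π` to match the angular range of polar coordinates.
    rw [Real.circleAverage_eq_integral_add (-Real.pi)] at hmv
    have hpi : (0 : ℝ) < 2 * Real.pi := by positivity
    have h2 : ((2 * Real.pi : ℝ) : ℂ) * g w =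
        ∫ θ in (0 : ℝ)..2 * Real.pi, g (circleMap w r (θ + -Real.pi)) := by
      rw [← hmv, Complex.real_smul, ← mul_assoc, ← Complex.ofReal_mul, mul_inv_cancel₀ hpi.ne']
      simp
    rw [intervalIntegral.integral_comp_add_right (fun θ => g (circleMap w r θ)),
      show (0 : ℝ) + -Real.pi = -Real.pi by ring, show 2 * Real.pi + -Real.pi = Real.pi by ring,
      intervalIntegral.integral_of_le (by linarith), integral_Ioc_eq_integral_Ioo] at h2
    calc ENNReal.ofReal (2 * Real.pi) * ‖g w‖ₑ = ‖((2 * Real.pi : ℝ) : ℂ) * g w‖ₑ := by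
          rw [enorm_mul]
          congr 1
          rw [← ofReal_norm, Complex.norm_real, Real.norm_of_nonneg hpi.le]
      _ ≤ ∫⁻ θ in Set.Ioo (-Real.pi) Real.pi, ‖g (circleMap w r θ)‖ₑ := by
          rw [h2]
          exact enorm_integral_le_lintegral_enorm _
      _ = _ := by
          refine lintegral_congr fun θ => ?_
          have e : w + Complex.polarCoord.symm (r, θ) = circleMap w r θ := by
            rw [Complex.polarCoord_symm_apply, circleMap, Complex.exp_mul_I]
            simp
          have hm : circleMap w r θ ∈ ball w ρ :=
            hsub (circleMap_mem_closedBall w hr.1.le θ)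
          rw [e, hG, Set.indicator_of_mem hm]
  calc ENNReal.ofReal (Real.pi * ρ ^ 2) * ‖g w‖ₑ
      = ∫⁻ r in Set.Ioo 0 ρ, ENNReal.ofReal r * (ENNReal.ofReal (2 * Real.pi) * ‖g w‖ₑ) := by
        rw [lintegral_mul_const _ ENNReal.measurable_ofReal, ← mul_assoc]
        congr 1
        rw [← ofReal_integral_eq_lintegral_ofReal, ← integral_Ioc_eq_integral_Ioo,
          ← intervalIntegral.integral_of_le hρ.le, integral_id,
          mul_comm (ENNReal.ofReal ((ρ ^ 2 - 0 ^ 2) / 2)), ← ENNReal.ofReal_mul (by positivity)]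
        · congr 1; ring
        · exact (continuous_id.integrableOn_Icc (a := 0) (b := ρ)).mono_set Set.Ioo_subset_Icc_self
        · exact (ae_restrict_mem measurableSet_Ioo).mono fun r hr => hr.1.le
    _ ≤ ∫⁻ r in Set.Ioo 0 ρ, ∫⁻ θ in Set.Ioo (-Real.pi) Real.pi,
          ENNReal.ofReal r • ‖G (w + Complex.polarCoord.symm (r, θ))‖ₑ := by
        refine setLIntegral_mono' measurableSet_Ioo fun r hr => ?_
        simp only [smul_eq_mul]
        rw [lintegral_const_mul' _ _ ENNReal.ofReal_ne_top]
        gcongr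
        exact hcirc r hr
    _ ≤ _ := lintegral_mono_set Set.Ioo_subset_Ioi_self

instance : IsFiniteMeasure discArea := ⟨by simp⟩

/-- Boundedness of point evaluations on the Bergman space. -/
lemma exists_norm_le_of_ball_subset {ρ : ℝ} (hρ : 0 < ρ) : ∃ K : ℝ≥0, ∀ (g : ℂ → ℂ) (w : ℂ),
    DifferentiableOn ℂ g (ball 0 1) → ball w ρ ⊆ ball 0 1 →
      ‖g w‖ₑ ≤ K * eLpNorm g 2 discArea := by
  set κ : ℝ≥0∞ := (ENNReal.ofReal (Real.pi * ρ ^ 2))⁻¹ *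
    discArea Set.univ ^ (1 / (1 : ℝ≥0∞).toReal - 1 / (2 : ℝ≥0∞).toReal) with hκ
  have hpos : ENNReal.ofReal (Real.pi * ρ ^ 2) ≠ 0 := by
    rw [Ne, ENNReal.ofReal_eq_zero, not_le]; positivity
  have hκt : κ ≠ ∞ := by
    refine ENNReal.mul_ne_top (ENNReal.inv_ne_top.2 hpos)
      (ENNReal.rpow_ne_top_of_nonneg (by norm_num) (measure_ne_top _ _))
  refine ⟨κ.toNNReal, fun g w hg hw => ?_⟩
  rw [ENNReal.coe_toNNReal hκt]
  have hgm : AEStronglyMeasurable g discArea :=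
    hg.continuousOn.aestronglyMeasurable measurableSet_ball
  have h1 := mul_enorm_le_lintegral_ball hρ (hg.mono hw)
  have h2 : ∫⁻ z in ball w ρ, ‖g z‖ₑ ≤ eLpNorm g 1 discArea := by
    rw [eLpNorm_one_eq_lintegral_enorm]
    exact lintegral_mono_set hw
  have h3 := eLpNorm_le_eLpNorm_mul_rpow_measure_univ (p := 1) (q := 2) (by norm_num) hgm
  calc ‖g w‖ₑ = (ENNReal.ofReal (Real.pi * ρ ^ 2))⁻¹ *
        (ENNReal.ofReal (Real.pi * ρ ^ 2) * ‖g w‖ₑ) := by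
        rw [← mul_assoc, ENNReal.inv_mul_cancel hpos ENNReal.ofReal_ne_top, one_mul]
    _ ≤ _ := mul_le_mul_right (h1.trans (h2.trans h3)) _
    _ = _ := by rw [hκ]; ring

lemma dslope_eq_div {g : ℂ → ℂ} {c z : ℂ} (hz : z ≠ c) :
    dslope g c z = (g z - g c) / (z - c) := by
  rw [dslope_of_ne _ hz, slope_def_field]

lemma ball_mem_nhds_center {c : ℂ} (hc : ‖c‖ < 1) : ball (0 : ℂ) 1 ∈ nhds c :=
  isOpen_ball.mem_nhds (by simpa using hc)

/-- Away from `c` the denominator is bounded below. Near `c` the maximum principle reduces the bound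
to a circle around `c`, where point evaluations are controlled by the norm. -/
lemma exists_eLpNorm_dslope_le {c : ℂ} (hc : ‖c‖ < 1) : ∃ K : ℝ≥0, ∀ g : ℂ → ℂ,
    DifferentiableOn ℂ g (ball 0 1) → MemLp g 2 discArea →
      eLpNorm (dslope g c) 2 discArea ≤ K * eLpNorm g 2 discArea := by
  -- Half the distance from `c` to the unit circle: balls of radius `ρ` about points of `closedBall
  -- c ρ` stay in the disc.
  set ρ : ℝ := (1 - ‖c‖) / 2 with hρd
  have hρ : 0 < ρ := by rw [hρd]; linarith
  obtain ⟨K, hK⟩ := exists_norm_le_of_ball_subset hρ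
  set V : ℝ≥0 := (discArea Set.univ ^ (1 / (2 : ℝ≥0∞).toReal)).toNNReal
  have hV : discArea Set.univ ^ (1 / (2 : ℝ≥0∞).toReal) = V :=
    (ENNReal.coe_toNNReal (ENNReal.rpow_ne_top_of_nonneg (by norm_num) (measure_ne_top _ _))).symm
  refine ⟨Real.toNNReal ρ⁻¹ + Real.toNNReal (2 * K / ρ) * V, fun g hg hgL => ?_⟩
  set A : ℝ := (eLpNorm g 2 discArea).toReal with hA
  have hAe : ENNReal.ofReal A = eLpNorm g 2 discArea := ENNReal.ofReal_toReal hgL.2.ne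
  have hsub : closedBall c ρ ⊆ ball 0 1 := by
    intro w hw
    rw [mem_closedBall, dist_eq_norm] at hw
    rw [mem_ball_zero_iff]
    have := norm_add_le (w - c) c
    rw [sub_add_cancel] at this
    linarith
  have hpt : ∀ w ∈ closedBall c ρ, ‖g w‖ ≤ K * A := by
    intro w hw
    have hb : ball w ρ ⊆ ball 0 1 := by
      intro z hz
      rw [mem_closedBall, dist_eq_norm] at hw
      rw [mem_ball, dist_eq_norm] at hz
      rw [mem_ball_zero_iff]
      have h1 := norm_add_le (z - w + (w - c)) c
      have h2 := norm_add_le (z - w) (w - c)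
      rw [sub_add_sub_cancel, sub_add_cancel] at h1
      rw [sub_add_sub_cancel] at h2
      linarith
    have := ENNReal.toReal_mono (ENNReal.mul_ne_top ENNReal.coe_ne_top hgL.2.ne) (hK g w hg hb)
    simpa [ENNReal.toReal_mul] using this
  have hgc : ‖g c‖ ≤ K * A := hpt c (mem_closedBall_self hρ.le)
  have hout : ∀ z, ρ ≤ ‖z - c‖ → ‖dslope g c z‖ ≤ ρ⁻¹ * (‖g z‖ + K * A) := by
    intro z hz
    have hne : z ≠ c := by
      rintro rfl
      simp at hz
      linarith
    rw [dslope_eq_div hne, norm_div, div_eq_inv_mul]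
    gcongr
    exact (norm_sub_le _ _).trans (by gcongr)
  have hin : ∀ z ∈ closedBall c ρ, ‖dslope g c z‖ ≤ 2 * K / ρ * A := by
    have hd : DiffContOnCl ℂ (dslope g c) (ball c ρ) :=
      (((Complex.differentiableOn_dslope (ball_mem_nhds_center hc)).2 hg).mono
        hsub).diffContOnCl_ball subset_rfl
    intro z hz
    refine Complex.norm_le_of_forall_mem_frontier_norm_le isBounded_ball hd (fun w hw => ?_)
      (by rwa [closure_ball _ hρ.ne'])
    rw [frontier_ball _ hρ.ne', mem_sphere, dist_eq_norm] at hw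
    refine (hout w hw.ge).trans ?_
    have := hpt w (by rw [mem_closedBall, dist_eq_norm]; exact hw.le)
    calc ρ⁻¹ * (‖g w‖ + K * A) ≤ ρ⁻¹ * (K * A + K * A) := by gcongr
      _ = _ := by ring
  have hA0 : 0 ≤ A := ENNReal.toReal_nonneg
  have hall : ∀ z, ‖dslope g c z‖ ≤ ‖ρ⁻¹ * ‖g z‖ + 2 * K / ρ * A‖ := by
    intro z
    rw [Real.norm_of_nonneg (by positivity)]
    rcases le_or_gt ρ ‖z - c‖ with hz | hz
    · refine (hout z hz).trans ?_
      have : 0 ≤ ρ⁻¹ * (K * A) := by positivity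
      calc ρ⁻¹ * (‖g z‖ + K * A) ≤ ρ⁻¹ * (‖g z‖ + K * A) + ρ⁻¹ * (K * A) := by linarith
        _ = _ := by ring
    · refine (hin z (by rw [mem_closedBall, dist_eq_norm]; exact hz.le)).trans ?_
      have : 0 ≤ ρ⁻¹ * ‖g z‖ := by positivity
      linarith
  calc eLpNorm (dslope g c) 2 discArea
      ≤ eLpNorm (fun z => ρ⁻¹ * ‖g z‖ + 2 * K / ρ * A) 2 discArea :=
        eLpNorm_mono hall
    _ ≤ eLpNorm (fun z => ρ⁻¹ * ‖g z‖) 2 discArea +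
          eLpNorm (fun _ => 2 * K / ρ * A) 2 discArea :=
        eLpNorm_add_le (hgL.1.norm.const_mul _) aestronglyMeasurable_const (by norm_num)
    _ = _ := by
        have e1 : eLpNorm (fun z => ρ⁻¹ * ‖g z‖) 2 discArea =
            (Real.toNNReal ρ⁻¹ : ℝ≥0∞) * eLpNorm g 2 discArea := by
          have := eLpNorm_const_smul ρ⁻¹ (fun z => ‖g z‖) 2 discArea
          rw [eLpNorm_norm] at this
          rw [show (fun z => ρ⁻¹ * ‖g z‖) = ρ⁻¹ • fun z => ‖g z‖ from rfl, this,
            Real.enorm_of_nonneg (by positivity)]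
          rfl
        have e2 : eLpNorm (fun _ : ℂ => 2 * K / ρ * A) 2 discArea =
            Real.toNNReal (2 * K / ρ) * eLpNorm g 2 discArea * V := by
          rw [eLpNorm_const' _ (by norm_num) (by norm_num), hV,
            Real.enorm_of_nonneg (by positivity), ENNReal.ofReal_mul (by positivity), hAe]
          rfl
        rw [e1, e2]
        push_cast
        ring

end Analysis

/-! ### Composition, multiplication and backward shift as bounded operators -/

section Operators

namespace IsHolomorphicRep

lemma memLp {f : bergmanSpace} {g : ℂ → ℂ} (h : IsHolomorphicRep f g) : MemLp g 2 discArea :=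
  (memLp_congr_ae h.2).1 (Lp.memLp (f : Lp ℂ 2 discArea))

lemma eqOn {f : bergmanSpace} {g g' : ℂ → ℂ} (h : IsHolomorphicRep f g)
    (h' : IsHolomorphicRep f g') : Set.EqOn g g' (ball 0 1) :=
  Measure.eqOn_open_of_ae_eq (h.2.symm.trans h'.2) isOpen_ball h.1.continuousOn h'.1.continuousOn

lemma ext {f f' : bergmanSpace} {g g' : ℂ → ℂ} (h : IsHolomorphicRep f g)
    (h' : IsHolomorphicRep f' g') (hgg : Set.EqOn g g' (ball 0 1)) : f = f' := by
  refine Subtype.ext (Lp.ext (h.2.trans (Filter.EventuallyEq.trans ?_ h'.2.symm)))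
  exact (ae_restrict_mem measurableSet_ball).mono hgg

lemma congr {f : bergmanSpace} {g g' : ℂ → ℂ} (h : IsHolomorphicRep f g)
    (hgg : Set.EqOn g g' (ball 0 1)) : IsHolomorphicRep f g' :=
  ⟨h.1.congr hgg.symm, h.2.trans ((ae_restrict_mem measurableSet_ball).mono hgg)⟩

lemma add {f f' : bergmanSpace} {g g' : ℂ → ℂ} (h : IsHolomorphicRep f g)
    (h' : IsHolomorphicRep f' g') : IsHolomorphicRep (f + f') (g + g') :=
  ⟨h.1.add h'.1, (Lp.coeFn_add _ _).trans (h.2.add h'.2)⟩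

lemma smul {f : bergmanSpace} {g : ℂ → ℂ} (s : ℂ) (h : IsHolomorphicRep f g) :
    IsHolomorphicRep (s • f) (s • g) :=
  ⟨h.1.const_smul s, (Lp.coeFn_smul _ _).trans (h.2.const_smul s)⟩

lemma zero : IsHolomorphicRep 0 0 :=
  ⟨differentiableOn_const _, Lp.coeFn_zero ℂ 2 discArea⟩

end IsHolomorphicRep

lemma exists_isHolomorphicRep (f : bergmanSpace) : ∃ g, IsHolomorphicRep f g := f.2

/-- A square integrable holomorphic function represents an element of the Bergman space. -/
lemma exists_isHolomorphicRep_of_memLp {g : ℂ → ℂ} (hg : DifferentiableOn ℂ g (ball 0 1))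
    (hgL : MemLp g 2 discArea) : ∃ f : bergmanSpace, IsHolomorphicRep f g :=
  ⟨⟨hgL.toLp g, g, hg, hgL.coeFn_toLp⟩, hg, hgL.coeFn_toLp⟩

/-- A linear transformation of holomorphic functions which is bounded in the `L²` norm
induces a bounded operator on the Bergman space. -/
lemma exists_clm_of_eLpNorm_le (T : (ℂ → ℂ) → ℂ → ℂ)
    (hcongr : ∀ g g', Set.EqOn g g' (ball 0 1) → Set.EqOn (T g) (T g') (ball 0 1))
    (hadd : ∀ g g', DifferentiableOn ℂ g (ball 0 1) → DifferentiableOn ℂ g' (ball 0 1) →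
      Set.EqOn (T (g + g')) (T g + T g') (ball 0 1))
    (hsmul : ∀ (s : ℂ) g, DifferentiableOn ℂ g (ball 0 1) →
      Set.EqOn (T (s • g)) (s • T g) (ball 0 1))
    (hT : ∀ g, DifferentiableOn ℂ g (ball 0 1) → DifferentiableOn ℂ (T g) (ball 0 1))
    (hbound : ∃ K : ℝ≥0, ∀ g, DifferentiableOn ℂ g (ball 0 1) → MemLp g 2 discArea →
      eLpNorm (T g) 2 discArea ≤ K * eLpNorm g 2 discArea) :
    ∃ X : bergmanSpace →L[ℂ] bergmanSpace, ∀ f g, IsHolomorphicRep f g →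
      IsHolomorphicRep (X f) (T g) := by
  obtain ⟨K, hK⟩ := hbound
  have hmem : ∀ {f : bergmanSpace} {g}, IsHolomorphicRep f g → MemLp (T g) 2 discArea := by
    intro f g h
    refine ⟨(hT g h.1).continuousOn.aestronglyMeasurable measurableSet_ball, ?_⟩
    exact (hK g h.1 h.memLp).trans_lt (ENNReal.mul_lt_top ENNReal.coe_lt_top h.memLp.2)
  choose r hr using exists_isHolomorphicRep
  choose Y hY using fun f => exists_isHolomorphicRep_of_memLp (hT _ (hr f).1) (hmem (hr f))
  -- By `hcongr` the chosen representative is immaterial on the disc; linearity of `Y` follows.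
  have hYg : ∀ f g, IsHolomorphicRep f g → IsHolomorphicRep (Y f) (T g) := fun f g h =>
    (hY f).congr (hcongr _ _ ((hr f).eqOn h))
  let L : bergmanSpace →ₗ[ℂ] bergmanSpace :=
    { toFun := Y
      map_add' := fun f f' => (hYg _ _ ((hr f).add (hr f'))).ext ((hY f).add (hY f'))
        (hadd _ _ (hr f).1 (hr f').1)
      map_smul' := fun s f => (hYg _ _ ((hr f).smul s)).ext ((hY f).smul s)
        (hsmul _ _ (hr f).1) }
  refine ⟨L.mkContinuous K fun f => ?_, hYg⟩
  have h1 := hK _ (hr f).1 (hr f).memLp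
  rw [← eLpNorm_congr_ae (hY f).2, ← eLpNorm_congr_ae (hr f).2] at h1
  have h2 := ENNReal.toReal_mono
    (ENNReal.mul_ne_top ENNReal.coe_ne_top (Lp.memLp (f : Lp ℂ 2 discArea)).2.ne) h1
  rw [ENNReal.toReal_mul, ENNReal.coe_toReal, ← Lp.norm_def, ← Lp.norm_def] at h2
  exact h2

lemma mapsTo_affineSelfMap {a c : ℂ} (ha : 0 < ‖a‖) (h : ‖a‖ + ‖1 - a‖ * ‖c‖ ≤ 1) :
    Set.MapsTo (affineSelfMap a c) (ball 0 1) (ball 0 1) := by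
  intro z hz
  rw [mem_ball_zero_iff] at hz ⊢
  calc ‖affineSelfMap a c z‖ = ‖a * z + (1 - a) * c‖ := by
        congr 1
        simp only [affineSelfMap]
        ring
    _ ≤ ‖a‖ * ‖z‖ + ‖1 - a‖ * ‖c‖ := by
        simpa only [norm_mul] using norm_add_le (a * z) ((1 - a) * c)
    _ < ‖a‖ * 1 + ‖1 - a‖ * ‖c‖ := by gcongr
    _ ≤ 1 := by linarith

lemma hasDerivAt_affineSelfMap (a c z : ℂ) : HasDerivAt (affineSelfMap a c) a z := by
  have := (((hasDerivAt_id z).sub_const c).const_mul a).add_const c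
  rwa [mul_one] at this

lemma differentiable_affineSelfMap (a c : ℂ) : Differentiable ℂ (affineSelfMap a c) :=
  fun z => (hasDerivAt_affineSelfMap a c z).differentiableAt

lemma exists_map_affineSelfMap {a : ℂ} (ha : a ≠ 0) (c : ℂ) :
    ∃ K : ℝ≥0, Measure.map (affineSelfMap a c) volume = (K : ℝ≥0∞) • volume := by
  let L : ℂ ≃ₗ[ℝ] ℂ := (LinearEquiv.smulOfNeZero ℂ ℂ a ha).restrictScalars ℝ
  have hdet : LinearMap.det (L : ℂ →ₗ[ℝ] ℂ) ≠ 0 := L.isUnit_det'.ne_zero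
  have hL := Measure.map_linearMap_addHaar_eq_smul_addHaar (volume : Measure ℂ) hdet
  refine ⟨Real.toNNReal |(LinearMap.det (L : ℂ →ₗ[ℝ] ℂ))⁻¹|, ?_⟩
  have hLa : ((L : ℂ →ₗ[ℝ] ℂ) : ℂ → ℂ) = fun z => a * z := by
    ext z; rfl
  rw [hLa] at hL
  have e : affineSelfMap a c = (fun z => z + (c - a * c)) ∘ fun z => a * z := by
    ext z
    simp only [affineSelfMap, Function.comp_apply]
    ring
  rw [e, ← Measure.map_map (by fun_prop) (by fun_prop), hL, Measure.map_smul,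
    map_add_right_eq_self]
  rfl

/-- Change of variables: `φ` scales area by a constant, and the disc lies inside the preimage of the
disc. -/
lemma exists_isCompositionOperator {a c : ℂ} (ha : a ≠ 0) (h : ‖a‖ + ‖1 - a‖ * ‖c‖ ≤ 1) :
    ∃ C : bergmanSpace →L[ℂ] bergmanSpace, IsCompositionOperator (affineSelfMap a c) C := by
  have hmaps := mapsTo_affineSelfMap (norm_pos_iff.2 ha) h
  refine exists_clm_of_eLpNorm_le (fun g => g ∘ affineSelfMap a c)
    (fun g g' hgg z hz => hgg (hmaps hz)) (fun _ _ _ _ _ _ => rfl) (fun _ _ _ _ _ => rfl)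
    (fun g hg => hg.comp (differentiable_affineSelfMap a c).differentiableOn hmaps) ?_
  obtain ⟨K, hK⟩ := exists_map_affineSelfMap ha c
  have hm : Measurable (affineSelfMap a c) := (differentiable_affineSelfMap a c).continuous.measurable
  have hres : Measure.map (affineSelfMap a c) (volume.restrict (affineSelfMap a c ⁻¹' ball 0 1)) =
      (K : ℝ≥0∞) • discArea := by
    rw [← Measure.restrict_map hm measurableSet_ball, hK, Measure.restrict_smul]
  refine ⟨K ^ (1 / (2 : ℝ≥0∞).toReal), fun g hg hgL => ?_⟩
  calc eLpNorm (g ∘ affineSelfMap a c) 2 discArea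
      ≤ eLpNorm (g ∘ affineSelfMap a c) 2 (volume.restrict (affineSelfMap a c ⁻¹' ball 0 1)) :=
        eLpNorm_mono_measure _ (Measure.restrict_mono hmaps le_rfl)
    _ = eLpNorm g 2 ((K : ℝ≥0∞) • discArea) := by
        rw [← hres, eLpNorm_map_measure _ hm.aemeasurable]
        rw [hres]
        exact hgL.1.smul_measure _
    _ = _ := by
        rw [eLpNorm_smul_measure_of_ne_top (by norm_num), ENNReal.coe_rpow_of_nonneg _ (by norm_num)]
        simp

lemma exists_isMultiplicationOperator {b : ℂ → ℂ} (hb : DifferentiableOn ℂ b (ball 0 1)) {K : ℝ≥0}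
    (hK : ∀ z ∈ ball (0 : ℂ) 1, ‖b z‖ ≤ K) :
    ∃ M : bergmanSpace →L[ℂ] bergmanSpace, IsMultiplicationOperator b M := by
  refine exists_clm_of_eLpNorm_le (fun g z => b z * g z)
    (fun g g' hgg z hz => by simp [hgg hz]) (fun g g' _ _ z _ => by simp [mul_add])
    (fun s g _ z _ => by simp [mul_left_comm]) (fun g hg => hb.mul hg) ⟨K, fun g hg hgL => ?_⟩
  refine (eLpNorm_le_nnreal_smul_eLpNorm_of_ae_le_mul
    ((ae_restrict_mem measurableSet_ball).mono fun z hz => ?_) 2).trans_eq rfl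
  rw [← NNReal.coe_le_coe, NNReal.coe_mul, coe_nnnorm, coe_nnnorm, norm_mul]
  exact mul_le_mul_of_nonneg_right (hK z hz) (norm_nonneg _)

lemma exists_backwardShift {c : ℂ} (hc : ‖c‖ < 1) : ∃ B : bergmanSpace →L[ℂ] bergmanSpace,
    ∀ f g, IsHolomorphicRep f g → IsHolomorphicRep (B f) (dslope g c) := by
  have hd : ∀ {g : ℂ → ℂ}, DifferentiableOn ℂ g (ball 0 1) → DifferentiableAt ℂ g c :=
    fun hg => hg.differentiableAt (ball_mem_nhds_center hc)
  have hcb : c ∈ ball (0 : ℂ) 1 := by simpa using hc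
  refine exists_clm_of_eLpNorm_le (fun g => dslope g c) (fun g g' hgg z hz => ?_)
    (fun g g' hg hg' z _ => ?_) (fun s g hg z _ => ?_)
    (fun g hg => (Complex.differentiableOn_dslope (ball_mem_nhds_center hc)).2 hg)
    (exists_eLpNorm_dslope_le hc)
  · rcases eq_or_ne z c with rfl | hne
    · simp only [dslope_same]
      exact Filter.EventuallyEq.deriv_eq
        (Filter.eventuallyEq_of_mem (ball_mem_nhds_center hc) hgg)
    · simp only [dslope_eq_div hne, hgg hz, hgg hcb]
  · rcases eq_or_ne z c with rfl | hne
    · simp only [dslope_same, Pi.add_apply]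
      exact deriv_add (hd hg) (hd hg')
    · simp only [dslope_eq_div hne, Pi.add_apply]
      ring
  · rcases eq_or_ne z c with rfl | hne
    · simp only [dslope_same, Pi.smul_apply]
      exact deriv_const_smul s (hd hg)
    · simp only [dslope_eq_div hne, Pi.smul_apply, smul_eq_mul]
      ring

/-- Identity theorem: `g` vanishes on the image of `φ`, which contains a neighbourhood of `c`. -/
lemma IsCompositionOperator.eq_zero_of_apply_eq_zero {a c : ℂ} (ha : a ≠ 0) (hc : ‖c‖ < 1)
    {C : bergmanSpace →L[ℂ] bergmanSpace} (hC : IsCompositionOperator (affineSelfMap a c) C)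
    {f : bergmanSpace} (hf : C f = 0) : f = 0 := by
  obtain ⟨g, hg⟩ := exists_isHolomorphicRep f
  have h0 : Set.EqOn (g ∘ affineSelfMap a c) 0 (ball 0 1) :=
    (hC f g hg).eqOn (hf ▸ IsHolomorphicRep.zero)
  refine hg.ext IsHolomorphicRep.zero ?_
  have hcb : c ∈ ball (0 : ℂ) 1 := by simpa using hc
  refine (hg.1.analyticOnNhd isOpen_ball).eqOn_zero_of_preconnected_of_eventuallyEq_zero
    (convex_ball (0 : ℂ) 1).isPreconnected hcb ?_
  have hψ : Filter.Tendsto (affineSelfMap a⁻¹ c) (nhds c) (nhds c) := by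
    have := (differentiable_affineSelfMap a⁻¹ c).continuous.tendsto c
    simpa [affineSelfMap] using this
  filter_upwards [hψ.eventually (ball_mem_nhds_center hc)] with z hz
  have := h0 hz
  simpa [affineSelfMap, mul_inv_cancel_left₀ ha] using this

lemma dslope_comp_affineSelfMap {a c : ℂ} (ha : a ≠ 0) {g : ℂ → ℂ} (hg : DifferentiableAt ℂ g c)
    (z : ℂ) : dslope g c (affineSelfMap a c z) = a⁻¹ * dslope (g ∘ affineSelfMap a c) c z := by
  have hφc : affineSelfMap a c c = c := by simp [affineSelfMap]
  rcases eq_or_ne z c with rfl | hne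
  · rw [hφc, dslope_same, dslope_same]
    have h1 : HasDerivAt g (deriv g z) (affineSelfMap a z z) := by
      rw [hφc]; exact hg.hasDerivAt
    rw [(h1.comp z (hasDerivAt_affineSelfMap a z z)).deriv]
    field_simp
  · have h1 : affineSelfMap a c z - c = a * (z - c) := by simp [affineSelfMap]
    have h2 : z - c ≠ 0 := sub_ne_zero.2 hne
    have h3 : affineSelfMap a c z ≠ c := by
      rw [← sub_ne_zero, h1]; exact mul_ne_zero ha h2
    rw [dslope_eq_div h3, dslope_eq_div hne, h1, Function.comp_apply, Function.comp_apply, hφc]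
    field_simp

end Operators

/-! ### Powers of the backward shift extend Toeplitz operators -/

section Toeplitz

/-- In polar coordinates about `c` the squared norm contains `∫ r⁻² r dr`, which diverges at `0`. -/
lemma not_memLp_inv_sub {c : ℂ} (hc : ‖c‖ < 1) :
    ¬ MemLp (fun z : ℂ => (z - c)⁻¹) 2 discArea := by
  intro hL
  set δ : ℝ := 1 - ‖c‖ with hδd
  have hδ : 0 < δ := by rw [hδd]; linarith
  have h1 : IntegrableOn (fun z : ℂ => ‖(z - c)⁻¹‖ ^ 2) (ball 0 1) := hL.integrable_norm_pow (by simp)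
  have hsub : ball c δ ⊆ ball 0 1 := ball_subset_ball' (by rw [dist_zero_right, hδd]; linarith)
  have h2 : IntegrableOn (fun x : ℂ => (‖x‖⁻¹) ^ 2) (ball 0 δ) := by
    have hp : (fun x : ℂ => x - c) ⁻¹' ball 0 δ = ball c δ := by
      ext x
      simp [dist_eq_norm]
    have := (measurePreserving_sub_right (volume : Measure ℂ) c).integrableOn_comp_preimage
      (MeasurableEquiv.subRight c).measurableEmbedding (f := fun x : ℂ => (‖x‖⁻¹) ^ 2)
      (s := ball 0 δ)
    rw [← this, hp]
    exact (h1.mono_set hsub).congr_fun (fun x _ => by simp) measurableSet_ball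
  rw [integrableOn_fun_norm_addHaar (E := ℂ) volume (f := fun y : ℝ => (y⁻¹) ^ 2),
    Complex.finrank_real_complex] at h2
  have h3 : IntervalIntegrable (fun x : ℝ => x⁻¹) volume 0 δ := by
    rw [intervalIntegrable_iff_integrableOn_Ioo_of_le hδ.le]
    refine h2.congr_fun (fun y hy => ?_) measurableSet_Ioo
    have := hy.1.ne'
    simp only [smul_eq_mul, Nat.add_one_sub_one, pow_one]
    field_simp
  rcases intervalIntegrable_inv_iff.1 h3 with h | h
  · exact hδ.ne h
  · exact h Set.left_mem_uIcc

lemma ae_ne_discArea (c : ℂ) : ∀ᵐ z ∂discArea, z ≠ c :=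
  ae_restrict_of_ae (compl_mem_ae_iff.2 (measure_singleton c))

variable {c : ℂ} {B : bergmanSpace →L[ℂ] bergmanSpace}

/-- A function in the Bergman space whose quotient by `(z - c) ^ k` is square integrable vanishes to
order `k` at `c`. -/
lemma eqOn_pow_mul_of_memLp (hc : ‖c‖ < 1)
    (hB : ∀ f g, IsHolomorphicRep f g → IsHolomorphicRep (B f) (dslope g c)) (k : ℕ)
    {f : bergmanSpace} {g h : ℂ → ℂ} (hg : IsHolomorphicRep f g)
    (hh : IsHolomorphicRep ((B ^ k) f) h)
    (hL : MemLp (fun z => (z - c) ^ (-(k : ℤ)) * g z) 2 discArea) :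
    Set.EqOn g (fun z => (z - c) ^ k * h z) (ball 0 1) := by
  induction k generalizing h with
  | zero => simpa using hg.eqOn hh
  | succ k ih =>
    obtain ⟨u, hu⟩ := exists_isHolomorphicRep ((B ^ k) f)
    -- Multiplying by `z - c`, bounded by `2` on the disc, lowers the order of the pole.
    have hLk : MemLp (fun z => (z - c) ^ (-(k : ℤ)) * g z) 2 discArea := by
      refine MemLp.of_le_mul (c := 2) hL ?_ ?_
      · have hm : Measurable fun z : ℂ => ((z - c) ^ k)⁻¹ := by fun_prop
        simp only [zpow_neg, zpow_natCast]
        exact hm.aestronglyMeasurable.mul hg.memLp.1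
      · filter_upwards [ae_restrict_mem measurableSet_ball, ae_ne_discArea c] with z hz hne
        rw [mem_ball_zero_iff] at hz
        have h2 : ‖z - c‖ ≤ 2 := (norm_sub_le _ _).trans (by linarith)
        have e : (z - c) ^ (-(k : ℤ)) * g z =
            (z - c) * ((z - c) ^ (-((k + 1 : ℕ) : ℤ)) * g z) := by
          rw [← mul_assoc, ← zpow_one_add₀ (sub_ne_zero.2 hne)]
          congr 2
          push_cast
          ring
        rw [e, norm_mul]
        gcongr
    have hgu := ih hu hLk
    have hBu : IsHolomorphicRep ((B ^ (k + 1)) f) (dslope u c) := by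
      rw [pow_succ', mul_apply_eq_comp]
      exact hB _ _ hu
    -- The quotient is `u / (z - c)`; subtracting the square integrable `dslope u c` leaves `u(c) /
    -- (z - c)`.
    have huc : u c = 0 := by
      by_contra hne
      apply not_memLp_inv_sub hc
      have h1 : MemLp (fun z => u c * (z - c)⁻¹) 2 discArea := by
        refine (memLp_congr_ae ?_).1 (hL.sub hBu.memLp)
        filter_upwards [ae_restrict_mem measurableSet_ball, ae_ne_discArea c] with z hz hzc
        have h0 : z - c ≠ 0 := sub_ne_zero.2 hzc
        rw [Pi.sub_apply, hgu hz, dslope_eq_div hzc, zpow_neg, zpow_natCast]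
        field_simp
        ring
      have h2 := h1.const_mul (u c)⁻¹
      simpa only [inv_mul_cancel_left₀ hne] using h2
    intro z hz
    have e := sub_smul_dslope u c z
    rw [huc, sub_zero, smul_eq_mul] at e
    simp only [hgu hz, pow_succ, mul_assoc, hh.eqOn hBu hz, e]

/-- Where the symbol times `f` is square integrable, `f` vanishes to order `k` at `c`. The product
is then already `B ^ k f`, and the projection does nothing. -/
lemma extendsToeplitzOperator_pow (hc : ‖c‖ < 1)
    (hB : ∀ f g, IsHolomorphicRep f g → IsHolomorphicRep (B f) (dslope g c)) (k : ℕ) :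
    ExtendsToeplitzOperator (fun z => (z - c) ^ (-(k : ℤ))) (B ^ k) := by
  intro f hs
  obtain ⟨g, hg⟩ := exists_isHolomorphicRep f
  obtain ⟨h, hh⟩ := exists_isHolomorphicRep ((B ^ k) f)
  have hgh := eqOn_pow_mul_of_memLp hc hB k hg hh <| (memLp_congr_ae <| by
    filter_upwards [hg.2] with z hz
    rw [hz]).1 hs
  have e : hs.toLp _ = ((B ^ k) f : Lp ℂ 2 discArea) := by
    refine Lp.ext (hs.coeFn_toLp.trans (Filter.EventuallyEq.trans ?_ hh.2.symm))
    filter_upwards [hg.2, ae_restrict_mem measurableSet_ball, ae_ne_discArea c] with z hz hzb hzc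
    rw [hz, hgh hzb, zpow_neg, zpow_natCast,
      inv_mul_cancel_left₀ (pow_ne_zero k (sub_ne_zero.2 hzc))]
  rw [e, sub_self]
  exact Submodule.zero_mem _

end Toeplitz

/-! ### The Bergman space operators form a scaled shift -/

section Shift

variable {c : ℂ} {M B : bergmanSpace →L[ℂ] bergmanSpace} {e : bergmanSpace}

lemma IsMultiplicationOperator.pow {b : ℂ → ℂ} (hM : IsMultiplicationOperator b M) (n : ℕ) :
    IsMultiplicationOperator (fun z => b z ^ n) (M ^ n) := by
  induction n with
  | zero => intro f g hg; simpa using hg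
  | succ n ih =>
    intro f g hg
    rw [pow_succ', mul_apply_eq_comp]
    simpa only [pow_succ', mul_assoc] using hM _ _ (ih f g hg)

lemma backwardShift_apply_shift (hc : ‖c‖ < 1)
    (hB : ∀ f g, IsHolomorphicRep f g → IsHolomorphicRep (B f) (dslope g c))
    (hM : IsMultiplicationOperator (fun z => z - c) M) (f : bergmanSpace) : B (M f) = f := by
  obtain ⟨g, hg⟩ := exists_isHolomorphicRep f
  refine (hB _ _ (hM f g hg)).ext hg fun z _ => ?_
  rcases eq_or_ne z c with rfl | hne
  · have hd := ((hasDerivAt_id z).sub_const z).mul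
      (hg.1.differentiableAt (ball_mem_nhds_center hc)).hasDerivAt
    rw [dslope_same]
    refine hd.deriv.trans ?_
    simp
  · rw [dslope_eq_div hne]
    simp only [sub_self, zero_mul, sub_zero]
    rw [mul_div_cancel_left₀ _ (sub_ne_zero.2 hne)]

lemma backwardShift_pow_apply_shift_pow (h : ∀ f, B (M f) = f) (n : ℕ) (f : bergmanSpace) :
    (B ^ n) ((M ^ n) f) = f := by
  induction n generalizing f with
  | zero => rfl
  | succ n ih =>
    rw [pow_succ, pow_succ', mul_apply_eq_comp, mul_apply_eq_comp, h, ih]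

lemma backwardShift_apply_one (hc : ‖c‖ < 1)
    (hB : ∀ f g, IsHolomorphicRep f g → IsHolomorphicRep (B f) (dslope g c))
    (he : IsHolomorphicRep e fun _ => 1) : B e = 0 := by
  refine (hB _ _ he).ext IsHolomorphicRep.zero fun z _ => ?_
  rcases eq_or_ne z c with rfl | hne
  · simp
  · simp [dslope_eq_div hne]

lemma ne_zero_of_isHolomorphicRep_one (he : IsHolomorphicRep e fun _ => 1) : e ≠ 0 := by
  rintro rfl
  exact one_ne_zero (he.eqOn IsHolomorphicRep.zero (mem_ball_self one_pos))

lemma isScaledShift_of_isCompositionOperator {a : ℂ} (hc : ‖c‖ < 1) (ha : a ≠ 0) (ha1 : ‖a‖ < 1)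
    {C : bergmanSpace →L[ℂ] bergmanSpace}
    (hC : IsCompositionOperator (affineSelfMap a c) C)
    (hM : IsMultiplicationOperator (fun z => z - c) M)
    (hB : ∀ f g, IsHolomorphicRep f g → IsHolomorphicRep (B f) (dslope g c))
    (he : IsHolomorphicRep e fun _ => 1) : IsScaledShift a C M B e where
  ne_zero := ha
  norm_lt_one := ha1
  comp_shift f := by
    obtain ⟨g, hg⟩ := exists_isHolomorphicRep f
    refine (hC _ _ (hM f g hg)).ext ((hM _ _ (hC f g hg)).smul a) fun z _ => ?_
    simp [affineSelfMap, mul_assoc]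
  comp_backward f := by
    obtain ⟨g, hg⟩ := exists_isHolomorphicRep f
    exact (hC _ _ (hB f g hg)).ext ((hB _ _ (hC f g hg)).smul a⁻¹) fun z _ =>
      dslope_comp_affineSelfMap ha (hg.1.differentiableAt (ball_mem_nhds_center hc)) z
  map_vector := (hC e _ he).ext he fun _ _ => rfl
  decomp f := by
    obtain ⟨g, hg⟩ := exists_isHolomorphicRep f
    refine ⟨g c, hg.ext ((he.smul (g c)).add (hM _ _ (hB f g hg))) fun z _ => ?_⟩
    have := sub_smul_dslope g c z
    rw [smul_eq_mul] at this
    simp [this]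
  inj f hf := hC.eq_zero_of_apply_eq_zero ha hc hf

end Shift

theorem theorem4p5 (a c : ℂ) (hc : ‖c‖ < 1)
    (hself : (c ≠ 0 ∧ ‖a‖ + ‖1 - a‖ * ‖c‖ ≤ 1) ∨ (‖a‖ < 1 ∧ c = 0))
    (htype : IsLoxodromic a ∨ IsHyperbolicNonautIII a c) :
    ∃ C : bergmanSpace →L[ℂ] bergmanSpace,
      IsCompositionOperator (affineSelfMap a c) C ∧
      extendedSpectrum C = {lam : ℂ | ∃ n : ℤ, lam = deriv (affineSelfMap a c) c ^ n} ∧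
      (∀ n : ℕ, ∃ M : bergmanSpace →L[ℂ] bergmanSpace,
        IsMultiplicationOperator (fun z => (z - c) ^ n) M ∧
        IsExtendedEigenoperator C (deriv (affineSelfMap a c) c ^ n) M) ∧
      (∀ k : ℕ, ∃ X : bergmanSpace →L[ℂ] bergmanSpace,
        ExtendsToeplitzOperator (fun z => (z - c) ^ (-(k : ℤ))) X ∧
        (∀ (j : ℕ) (p : bergmanSpace), j < k →
          IsHolomorphicRep p (fun z => (z - c) ^ j) → X p = 0) ∧
        IsExtendedEigenoperator C (deriv (affineSelfMap a c) c ^ (-(k : ℤ))) X) := by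
  have ha : a ≠ 0 ∧ ‖a‖ ≠ 1 := by
    rcases htype with h | ⟨⟨r, hr0, hr1, rfl⟩, -, -⟩
    · exact ⟨h.1, h.2.1⟩
    · exact ⟨by exact_mod_cast hr0.ne', by simpa [abs_of_pos hr0] using hr1⟩
  obtain ⟨ha0, hne⟩ := ha
  have hself' : ‖a‖ + ‖1 - a‖ * ‖c‖ ≤ 1 := by
    rcases hself with h | ⟨h, rfl⟩
    · exact h.2
    · simpa using h.le
  -- The self-map inequality gives `‖a‖ ≤ 1`, and both types of map exclude equality.
  have ha1 : ‖a‖ < 1 :=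
    lt_of_le_of_ne ((le_add_of_nonneg_right (by positivity)).trans hself') hne
  obtain ⟨C, hC⟩ := exists_isCompositionOperator ha0 hself'
  obtain ⟨M, hM⟩ := exists_isMultiplicationOperator (b := fun z => z - c) (K := 2) (by fun_prop)
    (fun z hz => by
      rw [mem_ball_zero_iff] at hz
      refine (norm_sub_le _ _).trans ?_
      push_cast
      linarith)
  obtain ⟨B, hB⟩ := exists_backwardShift hc
  obtain ⟨e, he⟩ := exists_isHolomorphicRep_of_memLp (g := fun _ => 1)
    (differentiableOn_const 1) (memLp_const 1)
  have hS := isScaledShift_of_isCompositionOperator hc ha0 ha1 hC hM hB he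
  have he0 := ne_zero_of_isHolomorphicRep_one he
  have hBM := backwardShift_pow_apply_shift_pow (backwardShift_apply_shift hc hB hM)
  have hMn : ∀ n : ℕ, IsExtendedEigenoperator C (a ^ n) (M ^ n) := by
    refine fun n => ⟨fun h0 => he0 ?_, ?_⟩
    · simpa [h0] using (hBM n e).symm
    · ext1 f
      exact hS.comp_shift_pow n f
  have hBn : ∀ n : ℕ, IsExtendedEigenoperator C (a ^ (-(n : ℤ))) (B ^ n) := by
    refine fun n => ⟨fun h0 => he0 ?_, ?_⟩
    · simpa [h0] using (hBM n e).symm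
    · ext1 f
      rw [zpow_neg, zpow_natCast]
      exact hS.comp_backward_pow n f
  rw [(hasDerivAt_affineSelfMap a c c).deriv]
  refine ⟨C, hC, Set.Subset.antisymm (fun lam => hS.exists_zpow_of_mem_extendedSpectrum) ?_,
    fun n => ⟨M ^ n, hM.pow n, hMn n⟩,
    fun k => ⟨B ^ k, extendsToeplitzOperator_pow hc hB k, fun j p hj hp => ?_, hBn k⟩⟩
  · rintro _ ⟨n, rfl⟩
    obtain ⟨m, rfl | rfl⟩ := n.eq_nat_or_neg
    · exact ⟨M ^ m, by simpa only [zpow_natCast] using hMn m⟩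
    · exact ⟨B ^ m, hBn m⟩
  -- With `k = j + i + 1`, `B ^ k M ^ j e = B ^ i (B e) = 0`.
  · have hpe : p = (M ^ j) e := hp.ext (hM.pow j e _ he) fun z _ => (mul_one _).symm
    obtain ⟨i, rfl⟩ := Nat.exists_eq_add_of_lt hj
    rw [hpe, show j + i + 1 = i + 1 + j by ring, pow_add, pow_add, pow_one, mul_apply_eq_comp,
      mul_apply_eq_comp, hBM, backwardShift_apply_one hc hB he, map_zero]
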